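/- Let $(\Omega,\mu)$ be a $\sigma$-compact topological space with a positive regular Borel measure, let $K:\Omega\to\mathbb{C}$ be $\mu$-measurable, and let $(A(u))_{u\in\Omega}$ be a $\mu$-measurable commuting family of self-adjoint (i.e. symmetric) real $n\times n$-matrices such that $A(u)$ is nonsingular for $\mu$-almost every $u$ with $K(u)\neq 0$ and $|\det A(u)|^{-1/2}K(u)\in L^1(\Omega,\mu)$. Then $(\mathcal{H}f)(x)=\int_\Omega K(u)f(A(u)x)\,d\mu(u)$ defines a bounded operator $\mathcal{H}=\mathcal{H}_{K,A}$ on $L^2(\mathbb{R}^n)$ (the integral converges absolutely for almost every $x$). There are orthogonal matrices $C$ such that all $C^{-1}A(u)C=\mathrm{diag}(a_1(u),\dots,a_n(u))$, $u\in\Omega$, are diagonal. Fix any such $C$ and any enumeration $U_1,\dots,U_{2^n}$ of the open hyperoctants of $\mathbb{R}^n$, and let $\varepsilon(i;j)\in\{-1,1\}^n$ be the sign vector with $\varepsilon(i;j)U_i=U_j$ (coordinatewise multiplication). The matrix symbol of $\mathcal{H}_{K,A}$ is the matrix function $\Phi=(\varphi_{ij})_{i,j=1}^{2^n}$ on $\mathbb{R}^n$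 with $$\varphi_{ij}(s)=\int_{\Omega_{ij}}K(u)\prod_{k=1}^n|a_k(u)|^{-1/2-\imath s_k}\,d\mu(u),\qquad \Omega_{ij}=\{u\in\Omega:(\mathrm{sgn}\,a_1(u),\dots,\mathrm{sgn}\,a_n(u))=\varepsilon(i;j)\}.$$ Then the adjoint operator $\mathcal{H}_{K,A}^*$ is again a Hausdorff operator satisfying the above assumptions, with kernel $\overline{K(v)}\,|\det A(v)|^{-1}$ and matrix family $A(v)^{-1}$ (where $A(v)$ is singular, the kernel and the matrix are set equal to $0$), this family is diagonalized by the same $C$, and the matrix symbol of $\mathcal{H}_{K,A}^*$ (for the same $C$ and the same enumeration) is the adjoint matrix $\Phi^*=(\overline{\varphi_{ij}})$, i.e. the conjugate transpose of $\Phi$, which equals its entrywise conjugate. Moreover, every other representation of $\mathcal{H}_{K,A}^*$ as a Hausdorff operator that satisfies the above assumptions (over a possibly different measure space) and whose matrices are diagonalized by $C$ has the same matrix symbol $\Phi^*$. -/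

import Mathlib

open MeasureTheory
open scoped ComplexConjugate Matrix

noncomputable section

namespace Hausdorff

/-- The space `ℝⁿ` of column vectors with the Euclidean norm and Lebesgue measure. -/
abbrev RSpace (n : ℕ) : Type := EuclideanSpace ℝ (Fin n)

/-- The complex Hilbert space `L²(ℝⁿ)`. -/
abbrev L2 (n : ℕ) : Type := Lp ℂ 2 (volume : Measure (RSpace n))

/-- The action of a real `n × n` matrix on column vectors. -/
def act {n : ℕ} (B : Matrix (Fin n) (Fin n) ℝ) (x : RSpace n) : RSpace n :=
  WithLp.toLp 2 (B *ᵥ x.ofLp)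

section Operator

variable {n : ℕ} {Ω : Type*} [MeasurableSpace Ω]

/-- The standing assumptions on a kernel `K` and a commuting family `A` of self-adjoint real
matrices: both are `μ`-measurable, `A u` is nonsingular for `μ`-almost every `u` with `K u ≠ 0`,
and `|det A|^(-1/2) K` is in `L¹(Ω, μ)`. -/
structure IsAdmissible (μ : Measure Ω) (K : Ω → ℂ) (A : Ω → Matrix (Fin n) (Fin n) ℝ) :
    Prop where
  kernel_measurable : AEMeasurable K μ
  family_measurable : ∀ k l, AEMeasurable (fun u => A u k l) μ
  nonsingular : ∀ᵐ u ∂μ, K u ≠ 0 → (A u).det ≠ 0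
  selfAdjoint : ∀ u, (A u).IsSymm
  commuting : ∀ u v, Commute (A u) (A v)
  integrable : Integrable (fun u => ((|(A u).det| ^ (-1 / 2 : ℝ) : ℝ) : ℂ) * K u) μ

/-- `T` is the Hausdorff operator `(T f)(x) = ∫ K(u) f(A(u) x) dμ(u)` on `L²(ℝⁿ)`: for every
`f` the integral converges absolutely for almost every `x` and equals `(T f)(x)`. -/
def IsHausdorffOperator (μ : Measure Ω) (K : Ω → ℂ) (A : Ω → Matrix (Fin n) (Fin n) ℝ)
    (T : L2 n →L[ℂ] L2 n) : Prop :=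
  ∀ f : L2 n, ∀ᵐ x : RSpace n,
    Integrable (fun u => K u * f (act (A u) x)) μ ∧
      T f x = ∫ u, K u * f (act (A u) x) ∂μ

/-- `C` is an orthogonal matrix such that all `C⁻¹ A(u) C` are diagonal. -/
structure Diagonalizes (C : Matrix (Fin n) (Fin n) ℝ) (A : Ω → Matrix (Fin n) (Fin n) ℝ) :
    Prop where
  orthogonal : C ∈ Matrix.orthogonalGroup (Fin n) ℝ
  isDiag : ∀ u, (C⁻¹ * A u * C).IsDiag

/-- The eigenvalues `a(u) = (a₁(u), …, aₙ(u))`: the diagonal of `A'(u) = C⁻¹ A(u) C`. -/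
def eigenvalues (C : Matrix (Fin n) (Fin n) ℝ) (A : Ω → Matrix (Fin n) (Fin n) ℝ)
    (u : Ω) (k : Fin n) : ℝ :=
  (C⁻¹ * A u * C) k k

/-- The open hyperoctant of `ℝⁿ` with sign vector `ε`. -/
def hyperoctant (ε : Fin n → ℤˣ) : Set (RSpace n) :=
  {x | ∀ k, 0 < ((ε k : ℤ) : ℝ) * x k}

/-- Coordinatewise multiplication by a sign vector. -/
def signMul (ε : Fin n → ℤˣ) (x : RSpace n) : RSpace n :=
  WithLp.toLp 2 fun k => ((ε k : ℤ) : ℝ) * x k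

/-- An enumeration `U₁, …, U_{2ⁿ}` of the open hyperoctants is given by an enumeration `e` of the
sign vectors, `U_j = hyperoctant (e j)`; then `transition e i j` is the sign vector `ε(i; j)`
with `ε(i; j) U_i = U_j`. -/
def transition (e : Fin (2 ^ n) ≃ (Fin n → ℤˣ)) (i j : Fin (2 ^ n)) : Fin n → ℤˣ :=
  e i * e j

lemma signMul_image_eq_iff (e : Fin (2 ^ n) ≃ (Fin n → ℤˣ)) (i j : Fin (2 ^ n))
    (ε : Fin n → ℤˣ) :
    signMul ε '' hyperoctant (e i) = hyperoctant (e j) ↔ ε = transition e i j := by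
  have sq : ∀ a : ℤˣ, (((a : ℤ) : ℝ)) * ((a : ℤ) : ℝ) = 1 := by
    intro a
    rcases Int.units_eq_one_or a with h | h <;> simp [h]
  have key : ∀ a b : ℤˣ, 0 < ((a : ℤ) : ℝ) * ((b : ℤ) : ℝ) → a = b := by
    intro a b
    rcases Int.units_eq_one_or a with h | h <;> rcases Int.units_eq_one_or b with h' | h' <;>
      simp [h, h']
  constructor
  · intro h
    have hx : signMul (e i) (WithLp.toLp 2 fun _ => (1 : ℝ)) ∈ hyperoctant (e i) := by
      intro k
      simp [signMul, sq]
    have hy : signMul ε (signMul (e i) (WithLp.toLp 2 fun _ => (1 : ℝ))) ∈ hyperoctant (e j) :=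
      h ▸ Set.mem_image_of_mem _ hx
    funext k
    have h1 := hy k
    simp only [signMul, mul_one] at h1
    have h2 : e j k = ε k * e i k := key _ _ (by push_cast; exact h1)
    simp only [transition, Pi.mul_apply, h2]
    rw [mul_comm (ε k), ← mul_assoc, Int.units_mul_self, one_mul]
  · rintro rfl
    ext y
    constructor
    · rintro ⟨x, hx, rfl⟩ k
      have h1 := hx k
      have h2 := sq (e j k)
      simp only [signMul, transition, Pi.mul_apply, Units.val_mul, Int.cast_mul]
      have : ((e j k : ℤ) : ℝ) * (((e i k : ℤ) : ℝ) * ((e j k : ℤ) : ℝ) * x k)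
          = (((e j k : ℤ) : ℝ) * ((e j k : ℤ) : ℝ)) * (((e i k : ℤ) : ℝ) * x k) := by ring
      rw [this, h2, one_mul]
      exact h1
    · intro hy
      refine ⟨signMul (transition e i j) y, ?_, ?_⟩
      · intro k
        have h1 := hy k
        have h2 := sq (e i k)
        simp only [signMul, transition, Pi.mul_apply, Units.val_mul, Int.cast_mul]
        have : ((e i k : ℤ) : ℝ) * (((e i k : ℤ) : ℝ) * ((e j k : ℤ) : ℝ) * y k)
            = (((e i k : ℤ) : ℝ) * ((e i k : ℤ) : ℝ)) * (((e j k : ℤ) : ℝ) * y k) := by ring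
        rw [this, h2, one_mul]
        exact h1
      · ext k
        simp only [signMul]
        rw [← mul_assoc, sq, one_mul]

/-- The set `Ω_{ij}` of all `u` with `(sgn a₁(u), …, sgn aₙ(u)) = ε(i; j)`. -/
def cell (C : Matrix (Fin n) (Fin n) ℝ) (e : Fin (2 ^ n) ≃ (Fin n → ℤˣ))
    (A : Ω → Matrix (Fin n) (Fin n) ℝ) (i j : Fin (2 ^ n)) : Set Ω :=
  {u | ∀ k, Real.sign (eigenvalues C A u k) = ((transition e i j k : ℤ) : ℝ)}

/-- The power `|a|^(-1/2 - is) = ∏ₖ exp((-1/2 - i sₖ) log |aₖ|)`. -/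
def absPow (a : Fin n → ℝ) (s : RSpace n) : ℂ :=
  ∏ k, Complex.exp ((-1 / 2 - Complex.I * (s k : ℂ)) * (Real.log |a k| : ℂ))

/-- The matrix symbol `Φ = (φ_{ij})` of the Hausdorff operator with kernel `K` and family `A`,
for the diagonalizing matrix `C` and the enumeration `e` of the hyperoctants:
`φ_{ij}(s) = ∫_{Ω_{ij}} K(u) |a(u)|^(-1/2 - is) dμ(u)`. -/
def matrixSymbol (C : Matrix (Fin n) (Fin n) ℝ) (e : Fin (2 ^ n) ≃ (Fin n → ℤˣ))
    (μ : Measure Ω) (K : Ω → ℂ) (A : Ω → Matrix (Fin n) (Fin n) ℝ) (s : RSpace n) :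
    Matrix (Fin (2 ^ n)) (Fin (2 ^ n)) ℂ :=
  Matrix.of fun i j => ∫ u in cell C e A i j, K u * absPow (eigenvalues C A u) s ∂μ

/-- The kernel `conj K(v) |det A(v)|⁻¹` of the adjoint operator. -/
def adjointKernel (K : Ω → ℂ) (A : Ω → Matrix (Fin n) (Fin n) ℝ) (v : Ω) : ℂ :=
  conj (K v) * ((|(A v).det|⁻¹ : ℝ) : ℂ)

end Operator

end Hausdorff

end

open MeasureTheory
open scoped ComplexConjugate Matrix

noncomputable section

namespace Hausdorff

/-! ### Simultaneous orthogonal diagonalization of the family -/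

section Diagonalization

/-! Boundedness is a weighted Cauchy–Schwarz inequality followed by Tonelli: the weight |det
A|^(-1/2)|K| leaves a factor whose square cancels the Jacobian of x ↦ A(u)x (`lintegral_sq_le`). The
adjoint is found by Fubini in the matrix coefficients and the substitution y = A(u)x
(`isHausdorffOperator_adjoint`). Its symbol follows from the scalar identity |a|⁻¹ |a|^(1/2+is) =
conj |a|^(-1/2-is), since a and 1/a have the same sign (`matrixSymbol_adjoint`); transposing changes
nothing because ε(i;j) = ε(j;i).

Independence of the representation needs no Mellin transform. In the coordinates y = C⁻¹x a
nonsingular A(u) permutes the hyperoctants by the signs of a(u) and multiplies |y|^(-1/2-is) by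
|a(u)|^(-1/2-is). Cutting this function off to the j-th octant and truncating it into L², then
applying the operator, gives in the limit φ_ij(s) |y|^(-1/2-is) on the i-th octant
(`ae_tendsto_truncatedCharacter`). The limit involves only the operator, so the operator determines
φ_ij(s) for every s (`matrixSymbol_unique`). -/

lemma act_eq_toEuclideanLin {n : ℕ} (B : Matrix (Fin n) (Fin n) ℝ) (x : RSpace n) :
    act B x = Matrix.toEuclideanLin B x := rfl

lemma isUnit_det_of_mem_orthogonalGroup {n : ℕ} {C : Matrix (Fin n) (Fin n) ℝ}
    (hC : C ∈ Matrix.orthogonalGroup (Fin n) ℝ) : IsUnit C.det :=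
  Matrix.isUnit_det_of_right_inverse ((Matrix.mem_orthogonalGroup_iff (Fin n) ℝ).mp hC)

/-- A commuting family of symmetric real matrices has an orthonormal basis of common
eigenvectors. -/
lemma exists_orthonormalBasis_eigenvectors {n : ℕ} {Ω : Type*}
    (A : Ω → Matrix (Fin n) (Fin n) ℝ) (hA : ∀ u, (A u).IsSymm)
    (hc : ∀ u v, Commute (A u) (A v)) :
    ∃ (b : OrthonormalBasis (Fin n) ℝ (RSpace n)) (α : Fin n → Ω → ℝ),
      ∀ u k, act (A u) (b k) = α k u • b k := by
  classical
  set T : Ω → Module.End ℝ (RSpace n) := fun u => Matrix.toEuclideanLin (A u) with hT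
  have hs : ∀ u, (T u).IsSymmetric := fun u => by
    rw [hT, Matrix.isSymmetric_toEuclideanLin_iff]
    exact (Matrix.conjTranspose_eq_transpose_of_trivial _).trans (hA u)
  have hcomm : Pairwise (Function.onFun Commute T) := by
    intro u v _
    refine LinearMap.ext fun x => ?_
    have h := (hc u v).eq
    simp only [hT, Module.End.mul_apply, ← act_eq_toEuclideanLin, act]
    rw [Matrix.mulVec_mulVec, Matrix.mulVec_mulVec, h]
  set V : (Ω → ℝ) → Submodule ℝ (RSpace n) := fun α => ⨅ u, (T u).eigenspace (α u) with hV
  have hint : DirectSum.IsInternal V :=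
    LinearMap.IsSymmetric.directSum_isInternal_of_pairwise_commute hs hcomm
  -- The index type `Ω → ℝ` may be infinite, but independent nonzero subspaces of a
  -- finite-dimensional space are finite in number; the zero summands are discarded.
  have hfin : {α | V α ≠ ⊥}.Finite :=
    WellFoundedGT.finite_ne_bot_of_iSupIndep hint.submodule_iSupIndep
  have : Fintype {α // V α ≠ ⊥} := hfin.fintype
  have hint' : DirectSum.IsInternal fun α : {α // V α ≠ ⊥} => V α :=
    DirectSum.isInternal_ne_bot_iff.mpr hint
  have horth : OrthogonalFamily ℝ (fun α : {α // V α ≠ ⊥} => V α) fun α => (V α).subtypeₗᵢ :=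
    (LinearMap.IsSymmetric.orthogonalFamily_iInf_eigenspaces hs).comp Subtype.val_injective
  have hn : Module.finrank ℝ (RSpace n) = n := by simp
  refine ⟨hint'.subordinateOrthonormalBasis hn horth,
    fun k => (hint'.subordinateOrthonormalBasisIndex hn k horth).1, fun u k => ?_⟩
  have h := hint'.subordinateOrthonormalBasis_subordinate hn k horth
  simp only [hV, Submodule.mem_iInf] at h
  exact Module.End.mem_eigenspace_iff.mp (h u)

/-- The columns of `C` are the common orthonormal eigenvectors. -/
lemma exists_diagonalizes {n : ℕ} {Ω : Type*}
    (A : Ω → Matrix (Fin n) (Fin n) ℝ) (hA : ∀ u, (A u).IsSymm)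
    (hc : ∀ u v, Commute (A u) (A v)) :
    ∃ C : Matrix (Fin n) (Fin n) ℝ, Diagonalizes C A := by
  obtain ⟨b, α, hb⟩ := exists_orthonormalBasis_eigenvectors A hA hc
  set C := (EuclideanSpace.basisFun (Fin n) ℝ).toBasis.toMatrix b with hC
  have hmem : C ∈ Matrix.orthogonalGroup (Fin n) ℝ :=
    OrthonormalBasis.toMatrix_orthonormalBasis_mem_orthogonal _ _
  have hCk : ∀ i k, C i k = b k i := fun i k => by
    simp [hC, Module.Basis.toMatrix_apply]
  have hdet := isUnit_det_of_mem_orthogonalGroup hmem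
  refine ⟨C, hmem, fun u => ?_⟩
  have h : A u * C = C * Matrix.diagonal fun k => α k u := by
    ext i k
    have h1 := congrArg (fun x : RSpace n => x i) (hb u k)
    simp only [act, PiLp.smul_apply, smul_eq_mul] at h1
    rw [Matrix.mul_diagonal, hCk, mul_comm, ← h1, Matrix.mul_apply]
    simp [Matrix.mulVec, dotProduct, hCk]
  rw [Matrix.mul_assoc, h, ← Matrix.mul_assoc, Matrix.nonsing_inv_mul _ hdet, one_mul]
  exact Matrix.isDiag_diagonal _

end Diagonalization

/-! ### Linear changes of variables and joint measurability -/

section Measurability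

variable {n : ℕ} {Ω : Type*} [MeasurableSpace Ω] {μ : Measure Ω} {K : Ω → ℂ}
  {A : Ω → Matrix (Fin n) (Fin n) ℝ}

lemma measurable_act (B : Matrix (Fin n) (Fin n) ℝ) : Measurable (act B) :=
  (LinearMap.continuous_of_finiteDimensional (Matrix.toEuclideanLin B)).measurable

lemma act_mul (B D : Matrix (Fin n) (Fin n) ℝ) (x : RSpace n) :
    act (B * D) x = act B (act D x) := by
  simp [act, Matrix.mulVec_mulVec]

lemma act_one (x : RSpace n) : act (1 : Matrix (Fin n) (Fin n) ℝ) x = x := by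
  simp [act]

lemma map_act_volume {B : Matrix (Fin n) (Fin n) ℝ} (hB : B.det ≠ 0) :
    Measure.map (act B) (volume : Measure (RSpace n)) =
      ENNReal.ofReal |B.det|⁻¹ • volume := by
  have hd : LinearMap.det (Matrix.toEuclideanLin B) = B.det := LinearMap.det_toLpLin _ _
  have h := Measure.map_linearMap_addHaar_eq_smul_addHaar (volume : Measure (RSpace n))
    (f := Matrix.toEuclideanLin B) (by rwa [hd])
  rw [hd, abs_inv] at h
  exact h

lemma lintegral_comp_act {B : Matrix (Fin n) (Fin n) ℝ} (hB : B.det ≠ 0)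
    {F : RSpace n → ENNReal} (hF : Measurable F) :
    ∫⁻ x, F (act B x) = ENNReal.ofReal |B.det|⁻¹ * ∫⁻ x, F x := by
  rw [← lintegral_map hF (measurable_act B), map_act_volume hB, lintegral_smul_measure,
    smul_eq_mul]

/-- The invertible linear change of variables `y = B x`. -/
lemma integral_comp_act {B : Matrix (Fin n) (Fin n) ℝ} (hB : B.det ≠ 0) {F : RSpace n → ℂ}
    (hF : AEStronglyMeasurable F volume) :
    ∫ x, F (act B x) = ((|B.det|⁻¹ : ℝ) : ℂ) * ∫ x, F x := by
  rw [← integral_map (measurable_act B).aemeasurable (f := F), map_act_volume hB,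
    integral_smul_measure, ENNReal.toReal_ofReal (by positivity), Complex.real_smul]
  rw [map_act_volume hB]
  exact hF.smul_measure _

lemma aemeasurable_det (hA : ∀ k l, AEMeasurable (fun u => A u k l) μ) :
    AEMeasurable (fun u => (A u).det) μ := by
  simp only [Matrix.det_apply]
  fun_prop

lemma aemeasurable_matrix_mul (hA : ∀ k l, AEMeasurable (fun u => A u k l) μ)
    (C D : Matrix (Fin n) (Fin n) ℝ) (k l : Fin n) :
    AEMeasurable (fun u => (C * A u * D) k l) μ := by
  simp only [Matrix.mul_apply]
  fun_prop

/-- Cramer's rule. The conventions for singular matrices and for 0⁻¹ match, so no case split is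
needed. -/
lemma aemeasurable_inv (hA : ∀ k l, AEMeasurable (fun u => A u k l) μ) (k l : Fin n) :
    AEMeasurable (fun u => (A u)⁻¹ k l) μ := by
  simp only [Matrix.inv_def, Matrix.smul_apply, Ring.inverse_eq_inv', smul_eq_mul,
    Matrix.adjugate_apply]
  refine (aemeasurable_det hA).inv.mul (aemeasurable_det fun i j => ?_)
  by_cases h : i = l
  · subst h
    simp only [Matrix.updateRow_self]
    fun_prop
  · simp only [Matrix.updateRow_ne h]
    exact hA i j

lemma aemeasurable_act_prod [SFinite μ] (hA : ∀ k l, AEMeasurable (fun u => A u k l) μ) :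
    AEMeasurable (fun p : RSpace n × Ω => act (A p.2) p.1) (volume.prod μ) := by
  refine (WithLp.measurable_toLp 2 _).comp_aemeasurable (aemeasurable_pi_lambda _ fun k => ?_)
  simp only [Matrix.mulVec, dotProduct]
  refine Finset.aemeasurable_fun_sum _ fun l _ => ((hA k l).comp_snd).mul ?_
  exact Measurable.aemeasurable (by fun_prop)

lemma aemeasurable_comp_act_prod [SFinite μ] {β : Type*} [MeasurableSpace β]
    (hA : ∀ k l, AEMeasurable (fun u => A u k l) μ)
    {f : RSpace n → β} (hf : Measurable f) :
    AEMeasurable (fun p : RSpace n × Ω => f (act (A p.2) p.1)) (volume.prod μ) :=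
  hf.comp_aemeasurable (aemeasurable_act_prod hA)

lemma aestronglyMeasurable_kernel_mul_comp_act_prod [SFinite μ] (h : IsAdmissible μ K A)
    {f : RSpace n → ℂ} (hf : Measurable f) :
    AEStronglyMeasurable (fun p : RSpace n × Ω => K p.2 * f (act (A p.2) p.1))
      (volume.prod μ) :=
  ((h.kernel_measurable.comp_snd).mul
    (aemeasurable_comp_act_prod h.family_measurable hf)).aestronglyMeasurable

end Measurability

/-! ### The L² estimate and insensitivity to null sets -/

section Bound

variable {n : ℕ} {Ω : Type*} [MeasurableSpace Ω] {μ : Measure Ω} {K : Ω → ℂ}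
  {A : Ω → Matrix (Fin n) (Fin n) ℝ}

/-- The `L¹`-norm of `|det A|^(-1/2) K`. -/
def kernelBound (μ : Measure Ω) (K : Ω → ℂ) (A : Ω → Matrix (Fin n) (Fin n) ℝ) : ENNReal :=
  ∫⁻ u, ‖((|(A u).det| ^ (-1 / 2 : ℝ) : ℝ) : ℂ) * K u‖ₑ ∂μ

lemma kernelBound_lt_top (h : IsAdmissible μ K A) : kernelBound μ K A < ⊤ :=
  h.integrable.hasFiniteIntegral

lemma aemeasurable_enorm_kernel_mul_comp_act_prod [SFinite μ] (h : IsAdmissible μ K A)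
    {F : RSpace n → ENNReal} (hF : Measurable F) :
    AEMeasurable (fun p : RSpace n × Ω => ‖K p.2‖ₑ * F (act (A p.2) p.1)) (volume.prod μ) :=
  (h.kernel_measurable.comp_snd.enorm).mul (aemeasurable_comp_act_prod h.family_measurable hF)

lemma ae_aemeasurable_prodMk_left {X Y : Type*} [MeasurableSpace X] [MeasurableSpace Y]
    {ρ : Measure X} {ν : Measure Y} [SFinite ν] {f : X × Y → ENNReal}
    (hf : AEMeasurable f (ρ.prod ν)) : ∀ᵐ x ∂ρ, AEMeasurable (fun y => f (x, y)) ν := by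
  filter_upwards [hf.aestronglyMeasurable.prodMk_left] with x hx
  exact hx.aemeasurable

/-- Cauchy–Schwarz with respect to a weight. -/
lemma sq_lintegral_mul_le {w G : Ω → ENNReal} (hw : AEMeasurable w μ) (hG : AEMeasurable G μ) :
    (∫⁻ u, w u * G u ∂μ) ^ 2 ≤ (∫⁻ u, w u ∂μ) * ∫⁻ u, w u * G u ^ 2 ∂μ := by
  have hsq : ∀ a : ENNReal, a ^ (1 / 2 : ℝ) * a ^ (1 / 2 : ℝ) = a := fun a => by
    rw [← ENNReal.rpow_add_of_nonneg _ _ (by norm_num) (by norm_num)]; norm_num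
  have h := ENNReal.lintegral_mul_le_Lp_mul_Lq μ Real.HolderConjugate.two_two
    (f := fun u => w u ^ (1 / 2 : ℝ)) (g := fun u => w u ^ (1 / 2 : ℝ) * G u)
    (hw.pow_const _) ((hw.pow_const _).mul hG)
  have h1 : ∀ u, ((fun u => w u ^ (1 / 2 : ℝ)) * fun u => w u ^ (1 / 2 : ℝ) * G u) u =
      w u * G u := fun u => by
    simp only [Pi.mul_apply]
    rw [← mul_assoc, hsq]
  have h2 : ∀ u, (w u ^ (1 / 2 : ℝ)) ^ (2 : ℝ) = w u := fun u => by
    rw [← ENNReal.rpow_mul]; norm_num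
  have h3 : ∀ u, (w u ^ (1 / 2 : ℝ) * G u) ^ (2 : ℝ) = w u * G u ^ 2 := fun u => by
    rw [ENNReal.mul_rpow_of_nonneg _ _ (by norm_num), h2]; norm_num
  simp only [h1, h2, h3] at h
  calc (∫⁻ u, w u * G u ∂μ) ^ 2
      ≤ ((∫⁻ u, w u ∂μ) ^ (1 / 2 : ℝ) * (∫⁻ u, w u * G u ^ 2 ∂μ) ^ (1 / 2 : ℝ)) ^ 2 := by
        gcongr
    _ = _ := by rw [mul_pow, pow_two, pow_two, hsq, hsq]

/-- The `L²`-bound for Hausdorff operators, for nonnegative functions. -/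
lemma lintegral_sq_le [SFinite μ] (h : IsAdmissible μ K A)
    {F : RSpace n → ENNReal} (hF : Measurable F) :
    ∫⁻ x, (∫⁻ u, ‖K u‖ₑ * F (act (A u) x) ∂μ) ^ 2 ≤
      kernelBound μ K A ^ 2 * ∫⁻ x, F x ^ 2 := by
  set w : Ω → ENNReal := fun u => ‖((|(A u).det| ^ (-1 / 2 : ℝ) : ℝ) : ℂ) * K u‖ₑ with hw
  -- Split |K| = w d almost everywhere: w is integrable, and d² = |det A| cancels the Jacobian
  -- factor after Tonelli.
  set d : Ω → ENNReal := fun u => ENNReal.ofReal (|(A u).det| ^ (1 / 2 : ℝ)) with hd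
  have hwm : AEMeasurable w μ := h.integrable.aestronglyMeasurable.aemeasurable.enorm
  have hdm : AEMeasurable d μ := by
    have := (aemeasurable_det h.family_measurable)
    exact ((this.norm).pow_const (1 / 2 : ℝ)).ennreal_ofReal
  have hKw : ∀ᵐ u ∂μ, ‖K u‖ₑ = w u * d u := by
    filter_upwards [h.nonsingular] with u hu
    by_cases hK : K u = 0
    · simp [hw, hK]
    have hp : 0 < |(A u).det| := abs_pos.mpr (hu hK)
    rw [hw, hd]
    simp only [enorm_mul]
    rw [mul_right_comm, ← ofReal_norm (((|(A u).det| ^ (-1 / 2 : ℝ) : ℝ) : ℂ)),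
      Complex.norm_real, Real.norm_of_nonneg (by positivity),
      ← ENNReal.ofReal_mul (by positivity), ← Real.rpow_add hp]
    norm_num
  have hpt : ∀ᵐ x : RSpace n, (∫⁻ u, ‖K u‖ₑ * F (act (A u) x) ∂μ) ^ 2 ≤
      kernelBound μ K A * ∫⁻ u, w u * (d u * F (act (A u) x)) ^ 2 ∂μ := by
    have hm := ae_aemeasurable_prodMk_left (aemeasurable_comp_act_prod h.family_measurable hF)
    filter_upwards [hm] with x hx
    rw [lintegral_congr_ae (g := fun u => w u * (d u * F (act (A u) x)))
      (by filter_upwards [hKw] with u hu; rw [hu, mul_assoc])]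
    exact sq_lintegral_mul_le hwm (hdm.mul hx)
  have hjoint : AEMeasurable (Function.uncurry fun (x : RSpace n) u =>
      w u * (d u * F (act (A u) x)) ^ 2) (volume.prod μ) :=
    hwm.comp_snd.mul ((hdm.comp_snd.mul
      (aemeasurable_comp_act_prod h.family_measurable hF)).pow_const 2)
  calc ∫⁻ x, (∫⁻ u, ‖K u‖ₑ * F (act (A u) x) ∂μ) ^ 2
      ≤ ∫⁻ x, kernelBound μ K A * ∫⁻ u, w u * (d u * F (act (A u) x)) ^ 2 ∂μ :=
        lintegral_mono_ae hpt
    _ = kernelBound μ K A * ∫⁻ x, ∫⁻ u, w u * (d u * F (act (A u) x)) ^ 2 ∂μ :=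
        lintegral_const_mul' _ _ (kernelBound_lt_top h).ne
    _ = kernelBound μ K A * ∫⁻ u, (∫⁻ x, w u * (d u * F (act (A u) x)) ^ 2) ∂μ := by
        rw [lintegral_lintegral_swap hjoint]
    _ = kernelBound μ K A * ∫⁻ u, w u * (∫⁻ x, F x ^ 2) ∂μ := by
        congr 1
        refine lintegral_congr_ae ?_
        filter_upwards [h.nonsingular] with u hu
        by_cases hK : K u = 0
        · simp [hw, hK]
        have hp : 0 < |(A u).det| := abs_pos.mpr (hu hK)
        have hm : Measurable fun x => F (act (A u) x) := hF.comp (measurable_act _)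
        rw [lintegral_const_mul _ ((hm.const_mul _).pow_const 2)]
        simp only [mul_pow]
        rw [lintegral_const_mul _ (hm.pow_const 2),
          lintegral_comp_act (hu hK) (F := fun x => F x ^ 2) (hF.pow_const 2),
          ← mul_assoc (d u ^ 2), hd]
        simp only
        rw [← ENNReal.ofReal_pow (by positivity), ← ENNReal.ofReal_mul (by positivity),
          ← Real.rpow_natCast, ← Real.rpow_mul hp.le]
        norm_num [hp.ne']
    _ = _ := by
        rw [lintegral_mul_const'' _ hwm, pow_two, mul_assoc]
        rfl

/-- Null sets of `ℝⁿ` are invisible to Hausdorff operators. -/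
lemma ae_ae_notMem [SFinite μ] (h : IsAdmissible μ K A) {N : Set (RSpace n)}
    (hN : volume N = 0) : ∀ᵐ x : RSpace n, ∀ᵐ u ∂μ, K u ≠ 0 → act (A u) x ∉ N := by
  -- The L² bound for the indicator of a measurable null superset has right-hand side zero.
  set N' := toMeasurable volume N
  have hN' : MeasurableSet N' := measurableSet_toMeasurable _ _
  have hF : Measurable (N'.indicator (1 : RSpace n → ENNReal)) := measurable_one.indicator hN'
  have h0 : ∫⁻ x, N'.indicator (1 : RSpace n → ENNReal) x ^ 2 = 0 := by
    rw [lintegral_eq_zero_iff (hF.pow_const 2)]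
    have : ∀ᵐ x : RSpace n, x ∉ N' := by
      rw [ae_iff]; simpa [N'] using hN
    filter_upwards [this] with x hx
    simp [hx]
  have hle := lintegral_sq_le h hF
  rw [h0, mul_zero, nonpos_iff_eq_zero] at hle
  have hj := aemeasurable_enorm_kernel_mul_comp_act_prod h hF
  rw [lintegral_eq_zero_iff' (hj.lintegral_prod_right'.pow_const 2)] at hle
  filter_upwards [hle, ae_aemeasurable_prodMk_left hj] with x hx hxm
  simp only [Pi.zero_apply, ne_eq, OfNat.ofNat_ne_zero, not_false_eq_true, pow_eq_zero_iff] at hx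
  rw [lintegral_eq_zero_iff' hxm] at hx
  filter_upwards [hx] with u hu hK hmem
  have : act (A u) x ∈ N' := subset_toMeasurable _ _ hmem
  simp [this, hK] at hu

/-- Allows a change of representative under the integral, hence linearity on L² classes. -/
lemma ae_ae_comp_act_eq [SFinite μ] (h : IsAdmissible μ K A) {f g : RSpace n → ℂ}
    (hfg : f =ᵐ[volume] g) :
    ∀ᵐ x : RSpace n, ∀ᵐ u ∂μ, K u * f (act (A u) x) = K u * g (act (A u) x) := by
  filter_upwards [ae_ae_notMem h (N := {x | f x ≠ g x}) hfg] with x hx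
  filter_upwards [hx] with u hu
  by_cases hK : K u = 0
  · simp [hK]
  · have := hu hK
    simp only [ne_eq, not_not] at this
    rw [this]

end Bound

/-! ### The bounded operator and its matrix coefficients -/

section Operator

variable {n : ℕ} {Ω : Type*} [MeasurableSpace Ω] {μ : Measure Ω} {K : Ω → ℂ}
  {A : Ω → Matrix (Fin n) (Fin n) ℝ}

/-- Genuine measurability matters: where A(u) is singular, preimages of null sets under x ↦ A(u)x
need not be null. -/
lemma measurable_coeFn_L2 (f : L2 n) : Measurable f := (Lp.stronglyMeasurable f).measurable

lemma eLpNorm_two_sq {X : Type*} [MeasurableSpace X] (ν : Measure X) (f : X → ℂ) :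
    eLpNorm f 2 ν ^ 2 = ∫⁻ x, ‖f x‖ₑ ^ 2 ∂ν := by
  have h := eLpNorm_nnreal_pow_eq_lintegral (μ := ν) (f := f) (p := 2) two_ne_zero
  simpa using h

lemma lintegral_enorm_sq_lt_top (f : L2 n) : ∫⁻ x, ‖f x‖ₑ ^ 2 < ⊤ := by
  rw [← eLpNorm_two_sq]
  exact ENNReal.pow_lt_top (Lp.memLp f).eLpNorm_lt_top

lemma lintegral_sq_kernel_lt_top [SFinite μ] (h : IsAdmissible μ K A) (f : L2 n) :
    ∫⁻ x, (∫⁻ u, ‖K u‖ₑ * ‖f (act (A u) x)‖ₑ ∂μ) ^ 2 < ⊤ :=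
  (lintegral_sq_le h (F := fun x => ‖f x‖ₑ) (measurable_coeFn_L2 f).enorm).trans_lt
    (ENNReal.mul_lt_top (ENNReal.pow_lt_top (kernelBound_lt_top h)) (lintegral_enorm_sq_lt_top f))

lemma aemeasurable_lintegral_kernel [SFinite μ] (h : IsAdmissible μ K A) (f : L2 n) :
    AEMeasurable (fun x => ∫⁻ u, ‖K u‖ₑ * ‖f (act (A u) x)‖ₑ ∂μ) volume :=
  (aemeasurable_enorm_kernel_mul_comp_act_prod h (F := fun x => ‖f x‖ₑ)
    (measurable_coeFn_L2 f).enorm).lintegral_prod_right'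

lemma ae_integrable_kernel_mul_comp_act [SFinite μ] (h : IsAdmissible μ K A) (f : L2 n) :
    ∀ᵐ x : RSpace n, Integrable (fun u => K u * f (act (A u) x)) μ := by
  filter_upwards [ae_lt_top' ((aemeasurable_lintegral_kernel h f).pow_const 2)
    (lintegral_sq_kernel_lt_top h f).ne,
    (aestronglyMeasurable_kernel_mul_comp_act_prod h (measurable_coeFn_L2 f)).prodMk_left]
    with x hx hm
  refine ⟨hm, ?_⟩
  simp only [HasFiniteIntegral, enorm_mul]
  exact lt_of_not_ge fun htop => by simp [top_le_iff.mp htop] at hx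

lemma eLpNorm_integral_le [SFinite μ] (h : IsAdmissible μ K A) (f : L2 n) :
    eLpNorm (fun x => ∫ u, K u * f (act (A u) x) ∂μ) 2 volume ≤
      kernelBound μ K A * eLpNorm f 2 volume := by
  rw [← ENNReal.pow_le_pow_left_iff two_ne_zero, mul_pow, eLpNorm_two_sq, eLpNorm_two_sq]
  refine le_trans (lintegral_mono fun x => ?_)
    (lintegral_sq_le h (F := fun x => ‖f x‖ₑ) (measurable_coeFn_L2 f).enorm)
  gcongr
  simpa only [enorm_mul] using
    enorm_integral_le_lintegral_enorm (μ := μ) fun u => K u * f (act (A u) x)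

lemma memLp_integral [SFinite μ] (h : IsAdmissible μ K A) (f : L2 n) :
    MemLp (fun x => ∫ u, K u * f (act (A u) x) ∂μ) 2 volume :=
  ⟨(aestronglyMeasurable_kernel_mul_comp_act_prod h
      (measurable_coeFn_L2 f)).integral_prod_right',
    (eLpNorm_integral_le h f).trans_lt
      (ENNReal.mul_lt_top (kernelBound_lt_top h) (Lp.memLp f).eLpNorm_lt_top)⟩

/-- The Hausdorff operator of an admissible pair, as a bounded operator on `L²(ℝⁿ)`. -/
def hausdorffOperator [SFinite μ] (h : IsAdmissible μ K A) : L2 n →L[ℂ] L2 n :=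
  LinearMap.mkContinuous
    { toFun := fun f => (memLp_integral h f).toLp _
      map_add' := fun f g => by
        rw [← MemLp.toLp_add]
        refine (MemLp.toLp_eq_toLp_iff _ _).mpr ?_
        filter_upwards [ae_integrable_kernel_mul_comp_act h f,
          ae_integrable_kernel_mul_comp_act h g,
          ae_ae_comp_act_eq h (Lp.coeFn_add f g)] with x hf hg hfg
        rw [integral_congr_ae hfg, Pi.add_apply, ← integral_add hf hg]
        simp only [Pi.add_apply, mul_add]
      map_smul' := fun c f => by
        rw [RingHom.id_apply, ← MemLp.toLp_const_smul]
        refine (MemLp.toLp_eq_toLp_iff _ _).mpr ?_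
        filter_upwards [ae_ae_comp_act_eq h (Lp.coeFn_smul c f)] with x hf
        rw [integral_congr_ae hf, Pi.smul_apply, smul_eq_mul, ← integral_const_mul]
        simp only [Pi.smul_apply, smul_eq_mul, mul_left_comm] }
    (kernelBound μ K A).toReal fun f => by
      simp only [LinearMap.coe_mk, AddHom.coe_mk]
      rw [Lp.norm_toLp, Lp.norm_def, ← ENNReal.toReal_mul]
      exact ENNReal.toReal_mono (ENNReal.mul_lt_top (kernelBound_lt_top h)
        (Lp.memLp f).eLpNorm_lt_top).ne (eLpNorm_integral_le h f)

lemma isHausdorffOperator_hausdorffOperator [SFinite μ] (h : IsAdmissible μ K A) :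
    IsHausdorffOperator μ K A (hausdorffOperator h) := fun f => by
  filter_upwards [ae_integrable_kernel_mul_comp_act h f, (memLp_integral h f).coeFn_toLp]
    with x hx hf
  exact ⟨hx, hf⟩

/-- The hypothesis of Fubini: |g| and x ↦ ∫ |K| |f(A(u)x)| are both square integrable, and ab ≤ a² +
b². -/
lemma integrable_prod_mul_kernel [SFinite μ] (h : IsAdmissible μ K A) (f g : L2 n) :
    Integrable (Function.uncurry fun (x : RSpace n) u =>
      conj (g x) * (K u * f (act (A u) x))) (volume.prod μ) := by
  have hg : Measurable fun x => conj (g x) :=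
    Complex.continuous_conj.measurable.comp (measurable_coeFn_L2 g)
  have hm : AEStronglyMeasurable (Function.uncurry fun (x : RSpace n) u =>
      conj (g x) * (K u * f (act (A u) x))) (volume.prod μ) :=
    (hg.comp measurable_fst).aestronglyMeasurable.mul
      (aestronglyMeasurable_kernel_mul_comp_act_prod h (measurable_coeFn_L2 f))
  refine ⟨hm, ?_⟩
  rw [HasFiniteIntegral, lintegral_prod _ hm.enorm]
  have hle : ∀ a b : ENNReal, a * b ≤ a ^ 2 + b ^ 2 := fun a b => by
    rcases le_total a b with hab | hab
    · exact le_trans (by rw [pow_two]; gcongr) le_add_self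
    · exact le_trans (by rw [pow_two]; gcongr) le_self_add
  calc ∫⁻ x, ∫⁻ u, ‖Function.uncurry (fun (x : RSpace n) u =>
        conj (g x) * (K u * f (act (A u) x))) (x, u)‖ₑ ∂μ
      = ∫⁻ x, ‖g x‖ₑ * ∫⁻ u, ‖K u‖ₑ * ‖f (act (A u) x)‖ₑ ∂μ := by
        refine lintegral_congr fun x => ?_
        rw [← lintegral_const_mul' _ _ enorm_ne_top]
        simp [enorm_mul]
    _ ≤ ∫⁻ x, (‖g x‖ₑ ^ 2 + (∫⁻ u, ‖K u‖ₑ * ‖f (act (A u) x)‖ₑ ∂μ) ^ 2) :=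
        lintegral_mono fun x => hle _ _
    _ = _ := lintegral_add_left ((measurable_coeFn_L2 g).enorm.pow_const 2) _
    _ < ⊤ := ENNReal.add_lt_top.mpr
        ⟨lintegral_enorm_sq_lt_top g, lintegral_sq_kernel_lt_top h f⟩

/-- The matrix coefficients of a Hausdorff operator. -/
lemma inner_eq_integral_integral [SFinite μ] (h : IsAdmissible μ K A) {T : L2 n →L[ℂ] L2 n}
    (hT : IsHausdorffOperator μ K A T) (f g : L2 n) :
    inner ℂ g (T f) = ∫ u, (∫ x, conj (g x) * (K u * f (act (A u) x))) ∂μ := by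
  rw [L2.inner_def, ← integral_integral_swap (integrable_prod_mul_kernel h f g)]
  refine integral_congr_ae ?_
  filter_upwards [hT f] with x hx
  rw [RCLike.inner_apply, hx.2, mul_comm, integral_const_mul]

end Operator

/-! ### The adjoint as a Hausdorff operator -/

section Adjoint

variable {n : ℕ} {Ω : Type*} [MeasurableSpace Ω] {μ : Measure Ω} {K : Ω → ℂ}
  {A : Ω → Matrix (Fin n) (Fin n) ℝ}

lemma det_inv_eq_inv (B : Matrix (Fin n) (Fin n) ℝ) : (B⁻¹).det = (B.det)⁻¹ := by
  rw [Matrix.det_nonsing_inv, Ring.inverse_eq_inv']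

/-- `Matrix.mul_inv_rev` also covers singular matrices, whose inverse is 0. -/
lemma commute_inv {B D : Matrix (Fin n) (Fin n) ℝ} (h : Commute B D) : Commute B⁻¹ D⁻¹ := by
  rw [commute_iff_eq, ← Matrix.mul_inv_rev, ← Matrix.mul_inv_rev, h.eq]

lemma kernel_ne_zero_of_adjointKernel {Ω : Type*} {K : Ω → ℂ}
    {A : Ω → Matrix (Fin n) (Fin n) ℝ} {u : Ω} (h : adjointKernel K A u ≠ 0) : K u ≠ 0 :=
  fun hK => h (by simp [adjointKernel, hK])

/-- Since |det A⁻¹|^(-1/2) |det A|⁻¹ = |det A|^(-1/2), the new weighted kernel is almost everywhere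
the conjugate of the old one. -/
lemma isAdmissible_adjoint (h : IsAdmissible μ K A) :
    IsAdmissible μ (adjointKernel K A) fun v => (A v)⁻¹ where
  kernel_measurable := by
    have h1 : AEMeasurable (fun u => conj (K u)) μ :=
      Complex.continuous_conj.measurable.comp_aemeasurable h.kernel_measurable
    have h2 : AEMeasurable (fun u => ((|(A u).det|⁻¹ : ℝ) : ℂ)) μ :=
      Complex.measurable_ofReal.comp_aemeasurable
        (aemeasurable_det h.family_measurable).norm.inv
    exact h1.mul h2
  family_measurable := aemeasurable_inv h.family_measurable
  nonsingular := by
    filter_upwards [h.nonsingular] with u hu hK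
    rw [det_inv_eq_inv]
    exact inv_ne_zero (hu (kernel_ne_zero_of_adjointKernel hK))
  selfAdjoint := fun u => by
    rw [Matrix.IsSymm, Matrix.transpose_nonsing_inv, h.selfAdjoint u]
  commuting := fun u v => commute_inv (h.commuting u v)
  integrable := by
    have hc := (Complex.conjCLE.toContinuousLinearMap).integrable_comp h.integrable
    refine hc.congr ?_
    filter_upwards [h.nonsingular] with u hu
    by_cases hK : K u = 0
    · simp [hK, adjointKernel]
    have hp : 0 < |(A u).det| := abs_pos.mpr (hu hK)
    have hr : |(A u).det| ^ (-1 / 2 : ℝ) = |(A u).det|⁻¹ ^ (-1 / 2 : ℝ) * |(A u).det|⁻¹ := by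
      rw [Real.inv_rpow hp.le, ← Real.rpow_neg hp.le]
      nth_rewrite 3 [← Real.rpow_one |(A u).det|]
      rw [← Real.rpow_neg hp.le, ← Real.rpow_add hp]
      norm_num
    simp only [det_inv_eq_inv, abs_inv, adjointKernel]
    simp only [ContinuousLinearEquiv.coe_coe, Complex.conjCLE_apply, map_mul, Complex.conj_ofReal]
    rw [hr]
    push_cast
    ring

lemma isHausdorffOperator_adjoint [SFinite μ] (h : IsAdmissible μ K A) {T : L2 n →L[ℂ] L2 n}
    (hT : IsHausdorffOperator μ K A T) :
    IsHausdorffOperator μ (adjointKernel K A) (fun v => (A v)⁻¹)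
      (ContinuousLinearMap.adjoint T) := by
  have h' := isAdmissible_adjoint h
  have hT' := isHausdorffOperator_hausdorffOperator h'
  suffices hausdorffOperator h' = ContinuousLinearMap.adjoint T from this ▸ hT'
  refine (ContinuousLinearMap.eq_adjoint_iff _ _).mpr fun f g => ?_
  rw [← inner_conj_symm, inner_eq_integral_integral h' hT', inner_eq_integral_integral h hT,
    ← integral_conj]
  refine integral_congr_ae ?_
  filter_upwards [h.nonsingular] with u hu
  by_cases hK : K u = 0
  · simp [hK, adjointKernel]
  have hunit : IsUnit (A u).det := (hu hK).isUnit
  have hF : Measurable fun y => conj (f (act (A u)⁻¹ y)) * (K u * g y) :=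
    (Complex.continuous_conj.measurable.comp
      ((measurable_coeFn_L2 f).comp (measurable_act _))).mul
      ((measurable_coeFn_L2 g).const_mul _)
  -- The substitution y = A(u)x; its Jacobian is the factor |det A(u)|⁻¹ of the adjoint kernel.
  have hcov := integral_comp_act (hu hK) hF.aestronglyMeasurable
  simp only [← act_mul, Matrix.nonsing_inv_mul _ hunit, act_one] at hcov
  rw [hcov, ← integral_conj, ← integral_const_mul]
  refine integral_congr_ae (Filter.Eventually.of_forall fun x => ?_)
  simp only [adjointKernel, map_mul, Complex.conj_conj, Complex.conj_ofReal]
  ring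

end Adjoint

/-! ### Eigenvalues and the diagonal action -/

section Eigenvalues

variable {n : ℕ} {Ω : Type*} {C : Matrix (Fin n) (Fin n) ℝ}
  {A : Ω → Matrix (Fin n) (Fin n) ℝ}

lemma Diagonalizes.isUnit_det (hC : Diagonalizes C A) : IsUnit C.det :=
  isUnit_det_of_mem_orthogonalGroup hC.orthogonal

lemma Diagonalizes.conj_eq_diagonal (hC : Diagonalizes C A) (u : Ω) :
    C⁻¹ * A u * C = Matrix.diagonal (eigenvalues C A u) :=
  (hC.isDiag u).diagonal_diag.symm

lemma Diagonalizes.det_eq_prod (hC : Diagonalizes C A) (u : Ω) :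
    (A u).det = ∏ k, eigenvalues C A u k := by
  rw [← Matrix.det_diagonal, ← hC.conj_eq_diagonal, Matrix.det_conj'
    ((Matrix.isUnit_iff_isUnit_det C).mpr hC.isUnit_det)]

lemma Diagonalizes.eigenvalues_ne_zero (hC : Diagonalizes C A) {u : Ω} (hu : (A u).det ≠ 0)
    (k : Fin n) : eigenvalues C A u k ≠ 0 := by
  rw [hC.det_eq_prod] at hu
  exact Finset.prod_ne_zero_iff.mp hu k (Finset.mem_univ k)

lemma conj_inv (hC : IsUnit C.det) (B : Matrix (Fin n) (Fin n) ℝ) :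
    C⁻¹ * B⁻¹ * C = (C⁻¹ * B * C)⁻¹ := by
  rw [Matrix.mul_inv_rev, Matrix.mul_inv_rev, Matrix.nonsing_inv_nonsing_inv _ hC,
    Matrix.mul_assoc]

lemma Diagonalizes.inv (hC : Diagonalizes C A) : Diagonalizes C fun v => (A v)⁻¹ where
  orthogonal := hC.orthogonal
  isDiag u := by
    rw [conj_inv hC.isUnit_det, hC.conj_eq_diagonal, Matrix.inv_diagonal]
    exact Matrix.isDiag_diagonal _

/-- Nonsingularity is essential: a single zero eigenvalue makes the whole inverse matrix 0. -/
lemma Diagonalizes.eigenvalues_inv (hC : Diagonalizes C A) {u : Ω} (hu : (A u).det ≠ 0)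
    (k : Fin n) : eigenvalues C (fun v => (A v)⁻¹) u k = (eigenvalues C A u k)⁻¹ := by
  have hunit : IsUnit (eigenvalues C A u) :=
    Pi.isUnit_iff.mpr fun k => (hC.eigenvalues_ne_zero hu k).isUnit
  have h1 : eigenvalues C A u * Ring.inverse (eigenvalues C A u) = 1 :=
    Ring.mul_inverse_cancel _ hunit
  have h2 := congrFun h1 k
  rw [eigenvalues, conj_inv hC.isUnit_det, hC.conj_eq_diagonal, Matrix.inv_diagonal,
    Matrix.diagonal_apply_eq]
  exact eq_inv_of_mul_eq_one_right h2

/-- In the coordinates `y = C⁻¹ x` the matrix `A u` acts by multiplication with the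
eigenvalues. -/
lemma Diagonalizes.act_inv_act (hC : Diagonalizes C A) (u : Ω) (x : RSpace n) (k : Fin n) :
    act C⁻¹ (act (A u) x) k = eigenvalues C A u k * act C⁻¹ x k := by
  have h : C⁻¹ * A u = Matrix.diagonal (eigenvalues C A u) * C⁻¹ := by
    rw [← hC.conj_eq_diagonal, Matrix.mul_assoc, Matrix.mul_nonsing_inv _ hC.isUnit_det, mul_one]
  rw [← act_mul, h, act_mul]
  exact Matrix.mulVec_diagonal (eigenvalues C A u) (act C⁻¹ x).ofLp k

end Eigenvalues

/-! ### The characters |a|^(-1/2 - is) -/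

section AbsPow

variable {n : ℕ}

/-- No condition on `a`: by log 0 = 0, a vanishing coordinate contributes the factor 1. -/
lemma absPow_ne_zero (a : Fin n → ℝ) (s : RSpace n) : absPow a s ≠ 0 :=
  Finset.prod_ne_zero_iff.mpr fun _ _ => Complex.exp_ne_zero _

lemma absPow_mul {a b : Fin n → ℝ} (ha : ∀ k, a k ≠ 0) (hb : ∀ k, b k ≠ 0) (s : RSpace n) :
    absPow (fun k => a k * b k) s = absPow a s * absPow b s := by
  simp only [absPow]
  rw [← Finset.prod_mul_distrib]
  refine Finset.prod_congr rfl fun k _ => ?_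
  rw [← Complex.exp_add, abs_mul, Real.log_mul (abs_ne_zero.mpr (ha k)) (abs_ne_zero.mpr (hb k))]
  push_cast
  ring_nf

lemma norm_absPow {a : Fin n → ℝ} (ha : ∀ k, a k ≠ 0) (s : RSpace n) :
    ‖absPow a s‖ = |∏ k, a k| ^ (-1 / 2 : ℝ) := by
  rw [absPow, norm_prod, Finset.abs_prod, ← Real.finsetProd_rpow _ _ fun k _ => abs_nonneg _]
  refine Finset.prod_congr rfl fun k _ => ?_
  rw [Complex.norm_exp, Real.rpow_def_of_pos (abs_pos.mpr (ha k)), mul_comm (Real.log _)]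
  congr 1
  simp [Complex.mul_re]

/-- Coordinatewise, |a|⁻¹ |a|^(1/2+is) = |a|^(-1/2+is); this turns the symbol of the adjoint into
the conjugate symbol. -/
lemma absPow_inv {a : Fin n → ℝ} (ha : ∀ k, a k ≠ 0) (s : RSpace n) :
    ((|∏ k, a k|⁻¹ : ℝ) : ℂ) * absPow (fun k => (a k)⁻¹) s = conj (absPow a s) := by
  rw [absPow, absPow, Finset.abs_prod, ← Finset.prod_inv_distrib, Complex.ofReal_prod,
    ← Finset.prod_mul_distrib, map_prod]
  refine Finset.prod_congr rfl fun k _ => ?_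
  rw [← Complex.exp_conj]
  have h : |a k|⁻¹ = Real.exp (-Real.log |a k|) := by
    rw [Real.exp_neg, Real.exp_log (abs_pos.mpr (ha k))]
  rw [abs_inv, Real.log_inv, h, Complex.ofReal_exp, ← Complex.exp_add]
  congr 1
  simp only [map_mul, map_sub, map_div₀, map_neg, map_one, Complex.conj_I, Complex.conj_ofReal,
    Complex.ofReal_neg]
  rw [show conj (2 : ℂ) = 2 from Complex.conj_ofNat 2]
  ring

lemma measurable_absPow (s : RSpace n) : Measurable fun a : Fin n → ℝ => absPow a s := by
  unfold absPow
  refine Finset.measurable_fun_prod _ fun k _ => Complex.measurable_exp.comp ?_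
  have h : Measurable fun a : Fin n → ℝ => Real.log |a k| :=
    Real.measurable_log.comp (measurable_pi_apply k).norm
  exact (Complex.measurable_ofReal.comp h).const_mul _

end AbsPow

/-! ### The matrix symbol of the adjoint -/

section Symbol

variable {n : ℕ} {Ω : Type*} [MeasurableSpace Ω] {μ : Measure Ω} {K : Ω → ℂ}
  {A : Ω → Matrix (Fin n) (Fin n) ℝ} {C : Matrix (Fin n) (Fin n) ℝ}

lemma measurable_sign : Measurable Real.sign := by
  unfold Real.sign
  exact Measurable.ite measurableSet_Iio measurable_const
    (Measurable.ite measurableSet_Ioi measurable_const measurable_const)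

lemma nullMeasurableSet_cell (hA : ∀ k l, AEMeasurable (fun u => A u k l) μ)
    (e : Fin (2 ^ n) ≃ (Fin n → ℤˣ)) (i j : Fin (2 ^ n)) :
    NullMeasurableSet (cell C e A i j) μ := by
  have h : cell C e A i j = ⋂ k, {u | Real.sign (eigenvalues C A u k) =
      ((transition e i j k : ℤ) : ℝ)} := by
    ext u; simp [cell]
  rw [h]
  exact NullMeasurableSet.iInter fun k => nullMeasurableSet_eq_fun
    (measurable_sign.comp_aemeasurable (aemeasurable_matrix_mul hA _ _ k k)) aemeasurable_const

lemma matrixSymbol_apply (hA : ∀ k l, AEMeasurable (fun u => A u k l) μ)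
    (e : Fin (2 ^ n) ≃ (Fin n → ℤˣ)) (s : RSpace n) (i j : Fin (2 ^ n)) :
    matrixSymbol C e μ K A s i j =
      ∫ u, (cell C e A i j).indicator (fun u => K u * absPow (eigenvalues C A u) s) u ∂μ := by
  rw [integral_indicator₀ (nullMeasurableSet_cell hA e i j)]
  rfl

lemma transition_comm (e : Fin (2 ^ n) ≃ (Fin n → ℤˣ)) (i j : Fin (2 ^ n)) :
    transition e i j = transition e j i :=
  mul_comm _ _

/-- A sign vector is its own inverse, so the same one leads from U_i to U_j and back. -/
lemma matrixSymbol_symm (e : Fin (2 ^ n) ≃ (Fin n → ℤˣ)) (s : RSpace n) (i j : Fin (2 ^ n)) :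
    matrixSymbol C e μ K A s i j = matrixSymbol C e μ K A s j i := by
  simp only [matrixSymbol, Matrix.of_apply, cell, transition_comm e i j]

lemma conjTranspose_matrixSymbol (e : Fin (2 ^ n) ≃ (Fin n → ℤˣ)) (s : RSpace n) :
    (matrixSymbol C e μ K A s)ᴴ = (matrixSymbol C e μ K A s).map conj := by
  ext i j
  rw [Matrix.conjTranspose_apply, Matrix.map_apply, matrixSymbol_symm, RCLike.star_def]

lemma matrixSymbol_adjoint (h : IsAdmissible μ K A) (hC : Diagonalizes C A)
    (e : Fin (2 ^ n) ≃ (Fin n → ℤˣ)) (s : RSpace n) :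
    matrixSymbol C e μ (adjointKernel K A) (fun v => (A v)⁻¹) s =
      (matrixSymbol C e μ K A s)ᴴ := by
  rw [conjTranspose_matrixSymbol]
  ext i j
  rw [Matrix.map_apply, matrixSymbol_apply (aemeasurable_inv h.family_measurable),
    matrixSymbol_apply h.family_measurable, ← integral_conj]
  refine integral_congr_ae ?_
  filter_upwards [h.nonsingular] with u hu
  by_cases hK : K u = 0
  · rw [Set.indicator_apply_eq_zero.mpr fun _ => by simp [adjointKernel, hK],
      Set.indicator_apply_eq_zero.mpr fun _ => by simp [hK], map_zero]
  -- Reciprocals keep their signs. The cells may differ where A(u) is singular, but there K = 0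
  -- almost everywhere.
  have hiff : u ∈ cell C e (fun v => (A v)⁻¹) i j ↔ u ∈ cell C e A i j := by
    refine forall_congr' fun k => ?_
    rw [hC.eigenvalues_inv (hu hK), Real.sign_inv]
  by_cases hmem : u ∈ cell C e A i j
  · rw [Set.indicator_of_mem hmem, Set.indicator_of_mem (hiff.mpr hmem),
      funext (hC.eigenvalues_inv (hu hK)), map_mul,
      ← absPow_inv (hC.eigenvalues_ne_zero (hu hK)), ← hC.det_eq_prod, adjointKernel, mul_assoc]
  · rw [Set.indicator_of_notMem hmem, Set.indicator_of_notMem (hiff.not.mpr hmem), map_zero]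

end Symbol

/-! ### The operator determines its symbol -/

section Uniqueness

variable {n : ℕ} {Ω : Type*} [MeasurableSpace Ω] {μ : Measure Ω} {K : Ω → ℂ}
  {A : Ω → Matrix (Fin n) (Fin n) ℝ} {C : Matrix (Fin n) (Fin n) ℝ}

/-- The rotated hyperoctant `C U`, where `U` has the sign vector `ε`. -/
def rotatedOctant (C : Matrix (Fin n) (Fin n) ℝ) (ε : Fin n → ℤˣ) : Set (RSpace n) :=
  act C⁻¹ ⁻¹' hyperoctant ε

/-- The generalized eigenfunction `x ↦ |C⁻¹ x|^(-1/2 - is)` of Hausdorff operators. -/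
def characterFun (C : Matrix (Fin n) (Fin n) ℝ) (s : RSpace n) (x : RSpace n) : ℂ :=
  absPow (act C⁻¹ x).ofLp s

/-- The truncation of `characterFun` to a rotated hyperoctant and to the set where `x` and the
function are bounded by `m`. -/
def truncatedCharacter (C : Matrix (Fin n) (Fin n) ℝ) (ε : Fin n → ℤˣ) (s : RSpace n) (m : ℕ) :
    RSpace n → ℂ :=
  (rotatedOctant C ε ∩ (Metric.closedBall 0 m ∩ {x | ‖characterFun C s x‖ ≤ m})).indicator
    (characterFun C s)

lemma isOpen_rotatedOctant (ε : Fin n → ℤˣ) : IsOpen (rotatedOctant C ε) := by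
  have hc : Continuous (act C⁻¹) :=
    LinearMap.continuous_of_finiteDimensional (Matrix.toEuclideanLin C⁻¹)
  refine IsOpen.preimage hc ?_
  have h : hyperoctant ε = ⋂ k, {x : RSpace n | 0 < ((ε k : ℤ) : ℝ) * x k} := by
    ext x; simp [hyperoctant]
  rw [h]
  exact isOpen_iInter_of_finite fun k => isOpen_lt continuous_const (by fun_prop)

lemma nonempty_rotatedOctant (hC : IsUnit C.det) (ε : Fin n → ℤˣ) :
    (rotatedOctant C ε).Nonempty := by
  refine ⟨act C (WithLp.toLp 2 fun k => ((ε k : ℤ) : ℝ)), fun k => ?_⟩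
  rw [← act_mul, Matrix.nonsing_inv_mul _ hC, act_one]
  rcases Int.units_eq_one_or (ε k) with h | h <;> simp [h]

lemma measurable_characterFun (s : RSpace n) : Measurable (characterFun C s) :=
  (measurable_absPow s).comp ((WithLp.measurable_ofLp 2 _).comp (measurable_act _))

/-- A function bounded by `m` on a set of finite measure. -/
lemma memLp_truncatedCharacter (ε : Fin n → ℤˣ) (s : RSpace n) (m : ℕ) :
    MemLp (truncatedCharacter C ε s m) 2 volume := by
  set S := rotatedOctant C ε ∩ (Metric.closedBall 0 m ∩ {x | ‖characterFun C s x‖ ≤ m}) with hS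
  have hSm : MeasurableSet S := (isOpen_rotatedOctant ε).measurableSet.inter
    (Metric.isClosed_closedBall.measurableSet.inter
      (measurableSet_le (measurable_characterFun s).norm measurable_const))
  have hfin : volume S < ⊤ :=
    (measure_mono fun x hx => hx.2.1).trans_lt (Metric.isBounded_closedBall (x := (0 : RSpace n))
      (r := m)).measure_lt_top
  have : IsFiniteMeasure (volume.restrict S) := ⟨by simpa using hfin⟩
  refine (memLp_indicator_iff_restrict hSm).mpr
    (MemLp.of_bound (measurable_characterFun s).aestronglyMeasurable m ?_)
  filter_upwards [ae_restrict_mem hSm] with x hx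
  exact hx.2.2

lemma norm_truncatedCharacter_le (ε : Fin n → ℤˣ) (s : RSpace n) (m : ℕ) (x : RSpace n) :
    ‖truncatedCharacter C ε s m x‖ ≤ ‖characterFun C s x‖ :=
  norm_indicator_le_norm_self _ _

lemma eventually_truncatedCharacter_eq (ε : Fin n → ℤˣ) (s : RSpace n) (x : RSpace n) :
    ∀ᶠ m : ℕ in Filter.atTop, truncatedCharacter C ε s m x =
      (rotatedOctant C ε).indicator (characterFun C s) x := by
  by_cases hx : x ∈ rotatedOctant C ε
  · filter_upwards [tendsto_natCast_atTop_atTop.eventually_ge_atTop ‖x‖,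
      tendsto_natCast_atTop_atTop.eventually_ge_atTop ‖characterFun C s x‖] with m h1 h2
    rw [truncatedCharacter, Set.indicator_of_mem hx, Set.indicator_of_mem]
    exact ⟨hx, by simpa using h1, h2⟩
  · refine Filter.Eventually.of_forall fun m => ?_
    rw [truncatedCharacter, Set.indicator_of_notMem hx,
      Set.indicator_of_notMem fun h => hx h.1]

lemma ne_zero_of_mem_rotatedOctant {ε : Fin n → ℤˣ} {x : RSpace n} (hx : x ∈ rotatedOctant C ε)
    (k : Fin n) : act C⁻¹ x k ≠ 0 := fun h => by
  have := hx k
  rw [h, mul_zero] at this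
  exact lt_irrefl _ this

/-- The eigenfunction property: A(u) acts diagonally in the coordinates C⁻¹x, which do not vanish on
an open octant, and `absPow` is multiplicative. -/
lemma characterFun_act {Ω : Type*} {A : Ω → Matrix (Fin n) (Fin n) ℝ}
    (hC : Diagonalizes C A) {u : Ω} (hu : (A u).det ≠ 0) {ε : Fin n → ℤˣ}
    {x : RSpace n} (hx : x ∈ rotatedOctant C ε) (s : RSpace n) :
    characterFun C s (act (A u) x) = absPow (eigenvalues C A u) s * characterFun C s x := by
  simp only [characterFun]
  rw [← absPow_mul (hC.eigenvalues_ne_zero hu) (ne_zero_of_mem_rotatedOctant hx)]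
  exact congrArg (fun a => absPow a s) (funext (hC.act_inv_act u x))

/-- One coordinate of `act_mem_rotatedOctant_iff`. For a = 0 both sides are false. -/
lemma sign_eq_mul_iff {a y : ℝ} {ε δ : ℤˣ} (hy : 0 < ((ε : ℤ) : ℝ) * y) :
    Real.sign a = (((ε * δ : ℤˣ) : ℤ) : ℝ) ↔ 0 < ((δ : ℤ) : ℝ) * (a * y) := by
  rcases lt_trichotomy a 0 with ha | ha | ha <;>
  rcases Int.units_eq_one_or ε with hε | hε <;> rcases Int.units_eq_one_or δ with hδ | hδ <;>
  subst hε hδ <;>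
  simp only [Units.val_one, Units.val_neg, Int.cast_one, Int.cast_neg, one_mul, neg_mul,
    mul_one, mul_neg, neg_neg, Left.neg_pos_iff] at hy ⊢ <;>
  first
  | (rw [Real.sign_of_neg ha]; constructor <;> intro h <;> nlinarith)
  | (rw [Real.sign_of_pos ha]; constructor <;> intro h <;> nlinarith)
  | (subst ha; simp)

lemma act_mem_rotatedOctant_iff {Ω : Type*} {A : Ω → Matrix (Fin n) (Fin n) ℝ}
    (hC : Diagonalizes C A) (e : Fin (2 ^ n) ≃ (Fin n → ℤˣ))
    {i j : Fin (2 ^ n)} {u : Ω} {x : RSpace n} (hx : x ∈ rotatedOctant C (e i)) :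
    act (A u) x ∈ rotatedOctant C (e j) ↔ u ∈ cell C e A i j := by
  refine forall_congr' fun k => ?_
  rw [hC.act_inv_act]
  exact (sign_eq_mul_iff (hx k)).symm

lemma integrable_kernel_mul_absPow (h : IsAdmissible μ K A) (hC : Diagonalizes C A)
    (s : RSpace n) : Integrable (fun u => K u * absPow (eigenvalues C A u) s) μ := by
  refine h.integrable.mono ?_ ?_
  · refine (h.kernel_measurable.mul
      ((measurable_absPow s).comp_aemeasurable ?_)).aestronglyMeasurable
    exact aemeasurable_pi_lambda _ fun k => aemeasurable_matrix_mul h.family_measurable _ _ k k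
  · filter_upwards [h.nonsingular] with u hu
    by_cases hK : K u = 0
    · simp [hK]
    rw [norm_mul, norm_mul, norm_absPow (hC.eigenvalues_ne_zero (hu hK)), ← hC.det_eq_prod,
      Complex.norm_real, Real.norm_of_nonneg (by positivity), mul_comm]

/-- A Hausdorff operator maps the truncated generalized eigenfunctions, in the limit, to multiples
of the generalized eigenfunction; the factors are the entries of the matrix symbol. -/
lemma ae_tendsto_truncatedCharacter [SFinite μ] (h : IsAdmissible μ K A) (hC : Diagonalizes C A)
    {T : L2 n →L[ℂ] L2 n} (hT : IsHausdorffOperator μ K A T)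
    (e : Fin (2 ^ n) ≃ (Fin n → ℤˣ)) (s : RSpace n) (i j : Fin (2 ^ n)) :
    ∀ᵐ x : RSpace n, x ∈ rotatedOctant C (e i) →
      Filter.Tendsto (fun m : ℕ => T ((memLp_truncatedCharacter (C := C) (e j) s m).toLp _) x)
        Filter.atTop (nhds (matrixSymbol C e μ K A s i j * characterFun C s x)) := by
  -- Countably many truncations, so one null set of x serves all of them.
  have h1 := ae_all_iff.mpr fun m : ℕ =>
    hT ((memLp_truncatedCharacter (C := C) (e j) s m).toLp _)
  have h2 := ae_all_iff.mpr fun m : ℕ =>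
    ae_ae_comp_act_eq h (memLp_truncatedCharacter (C := C) (e j) s m).coeFn_toLp
  filter_upwards [h1, h2] with x hx1 hx2 hx
  have heq : ∀ m : ℕ, T ((memLp_truncatedCharacter (C := C) (e j) s m).toLp _) x =
      ∫ u, K u * truncatedCharacter C (e j) s m (act (A u) x) ∂μ := fun m => by
    rw [(hx1 m).2, integral_congr_ae (hx2 m)]
  simp only [heq]
  rw [matrixSymbol_apply h.family_measurable, ← integral_mul_const]
  -- The truncation at A(u)x is dominated by the full character, which factors by
  -- `characterFun_act`; for fixed u the integrands are eventually constant in m.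
  refine tendsto_integral_of_dominated_convergence
    (fun u => ‖K u * absPow (eigenvalues C A u) s‖ * ‖characterFun C s x‖)
    (fun m => ((hx1 m).1.congr (hx2 m)).aestronglyMeasurable)
    ((integrable_kernel_mul_absPow h hC s).norm.mul_const _) (fun m => ?_) ?_
  · filter_upwards [h.nonsingular] with u hu
    by_cases hK : K u = 0
    · simp [hK]
    rw [← norm_mul, mul_assoc, ← characterFun_act hC (hu hK) hx, norm_mul, norm_mul]
    gcongr
    exact norm_truncatedCharacter_le _ _ _ _
  · filter_upwards [h.nonsingular] with u hu
    refine tendsto_nhds_of_eventually_eq ?_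
    filter_upwards [eventually_truncatedCharacter_eq (C := C) (e j) s (act (A u) x)] with m hm
    rw [hm]
    by_cases hK : K u = 0
    · rw [hK, zero_mul, Set.indicator_apply_eq_zero.mpr fun _ => by simp [hK], zero_mul]
    by_cases hmem : u ∈ cell C e A i j
    · rw [Set.indicator_of_mem hmem,
        Set.indicator_of_mem ((act_mem_rotatedOctant_iff hC e hx).mpr hmem),
        characterFun_act hC (hu hK) hx, mul_assoc]
    · rw [Set.indicator_of_notMem hmem,
        Set.indicator_of_notMem ((act_mem_rotatedOctant_iff hC e hx).not.mpr hmem),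
        mul_zero, zero_mul]

/-- The matrix symbol depends only on the operator, not on its representation. -/
lemma matrixSymbol_unique [SFinite μ] (h : IsAdmissible μ K A) (hC : Diagonalizes C A)
    {T : L2 n →L[ℂ] L2 n} (hT : IsHausdorffOperator μ K A T)
    {Ω' : Type*} [MeasurableSpace Ω'] {μ' : Measure Ω'} [SFinite μ'] {K' : Ω' → ℂ}
    {A' : Ω' → Matrix (Fin n) (Fin n) ℝ} (h' : IsAdmissible μ' K' A')
    (hC' : Diagonalizes C A') (hT' : IsHausdorffOperator μ' K' A' T)
    (e : Fin (2 ^ n) ≃ (Fin n → ℤˣ)) (s : RSpace n) :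
    matrixSymbol C e μ' K' A' s = matrixSymbol C e μ K A s := by
  ext i j
  have hae := (ae_tendsto_truncatedCharacter h' hC' hT' e s i j).and
    (ae_tendsto_truncatedCharacter h hC hT e s i j)
  -- A conull set is dense, so it meets the open octant; at one such point the two limits agree and
  -- the nonzero character cancels.
  obtain ⟨x, hxo, hx⟩ := (Measure.dense_of_ae hae).inter_open_nonempty _
    (isOpen_rotatedOctant (e i)) (nonempty_rotatedOctant hC.isUnit_det (e i))
  exact mul_right_cancel₀ (absPow_ne_zero _ s) (tendsto_nhds_unique (hx.1 hxo) (hx.2 hxo))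

end Uniqueness

end Hausdorff

end

theorem corollary4 {n : ℕ} {Ω : Type*} [TopologicalSpace Ω] [SigmaCompactSpace Ω]
    [MeasurableSpace Ω] [BorelSpace Ω] (μ : Measure Ω) [μ.Regular]
    (K : Ω → ℂ) (A : Ω → Matrix (Fin n) (Fin n) ℝ)
    (hKA : Hausdorff.IsAdmissible μ K A) :
    -- the family `A` can be diagonalized by an orthogonal matrix
    (∃ C : Matrix (Fin n) (Fin n) ℝ, Hausdorff.Diagonalizes C A) ∧
    -- the Hausdorff operator `H` exists as a bounded operator on `L²(ℝⁿ)`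
    ∃ H : Hausdorff.L2 n →L[ℂ] Hausdorff.L2 n, Hausdorff.IsHausdorffOperator μ K A H ∧
      -- its adjoint is the Hausdorff operator of an admissible pair
      Hausdorff.IsAdmissible μ (Hausdorff.adjointKernel K A) (fun v => (A v)⁻¹) ∧
      Hausdorff.IsHausdorffOperator μ (Hausdorff.adjointKernel K A) (fun v => (A v)⁻¹)
        (ContinuousLinearMap.adjoint H) ∧
      -- for every choice of the diagonalizing matrix and of the enumeration of the hyperoctants
      ∀ (C : Matrix (Fin n) (Fin n) ℝ) (e : Fin (2 ^ n) ≃ (Fin n → ℤˣ)),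
        Hausdorff.Diagonalizes C A →
        -- the same matrix diagonalizes the family of the adjoint, whose matrix symbol is `Φ*`
        Hausdorff.Diagonalizes C (fun v => (A v)⁻¹) ∧
        (∀ s, Hausdorff.matrixSymbol C e μ (Hausdorff.adjointKernel K A) (fun v => (A v)⁻¹) s =
          (Hausdorff.matrixSymbol C e μ K A s)ᴴ) ∧
        -- and the same holds for every representation of the adjoint as a Hausdorff operator
        (∀ (Ω' : Type*) [TopologicalSpace Ω'] [SigmaCompactSpace Ω'] [MeasurableSpace Ω']
          [BorelSpace Ω'] (μ' : Measure Ω') [μ'.Regular] (K' : Ω' → ℂ)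
          (A' : Ω' → Matrix (Fin n) (Fin n) ℝ),
          Hausdorff.IsAdmissible μ' K' A' → Hausdorff.Diagonalizes C A' →
          Hausdorff.IsHausdorffOperator μ' K' A' (ContinuousLinearMap.adjoint H) →
          ∀ s, Hausdorff.matrixSymbol C e μ' K' A' s =
            (Hausdorff.matrixSymbol C e μ K A s)ᴴ) ∧
        -- where `Φ* = (conj φ_{ij})`
        (∀ s, (Hausdorff.matrixSymbol C e μ K A s)ᴴ =
          (Hausdorff.matrixSymbol C e μ K A s).map conj) := by
  -- Regularity and σ-compactness enter only through s-finiteness of the measure, which Tonelli and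
  -- Fubini require.
  have hH := Hausdorff.isHausdorffOperator_hausdorffOperator hKA
  have hadj := Hausdorff.isHausdorffOperator_adjoint hKA hH
  refine ⟨Hausdorff.exists_diagonalizes A hKA.selfAdjoint hKA.commuting,
    Hausdorff.hausdorffOperator hKA, hH, Hausdorff.isAdmissible_adjoint hKA, hadj,
    fun C e hC => ⟨hC.inv, Hausdorff.matrixSymbol_adjoint hKA hC e, ?_,
      Hausdorff.conjTranspose_matrixSymbol e⟩⟩
  intro Ω' _ _ _ _ μ' _ K' A' hKA' hC' hH' s
  rw [← Hausdorff.matrixSymbol_adjoint hKA hC e s]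
  exact Hausdorff.matrixSymbol_unique (Hausdorff.isAdmissible_adjoint hKA) hC.inv hadj
    hKA' hC' hH' e s
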